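/- Let $d$ be a natural number, and let $\Delta$ be the discrete Laplacian on $\mathbb{Z}^d$ given by the sum over nearest neighbors, $(\Delta f)(n)=\sum_{j=1}^d \big(f(n+e_j)+f(n-e_j)\big)$, where $e_1,\dots,e_d$ are the standard coordinate vectors. Let $V\in\ell^\infty(\mathbb{Z}^d)$ be real-valued, acting by multiplication, and consider the bounded self-adjoint operator $H=\Delta+V$ on $\ell^2(\mathbb{Z}^d)$, with spectral resolution $\mathcal{E}$ (the projection-valued Borel measure on $\mathbb{R}$ with $H=\int\lambda\,\mathcal{E}(d\lambda)$). Write $\langle n\rangle=(1+|n|^2)^{1/2}$ with the Euclidean norm $|n|$. Fix a real number $\sigma>\frac d2$. Then for almost every $E\in\mathbb{R}$ with respect to the spectral measure of $H$, i.e., for all $E$ outside a Borel set $N\subset\mathbb{R}$ with $\mathcal{E}(N)=0$, there exists $\psi:\mathbb{Z}^d\to\mathbb{R}$, not identically vanishing, such that $H\psi=E\psi$ pointwise on $\mathbb{Z}^d$ and $$|\psi(n)|\le C(d,\sigma,E)\,\langle n\rangle^\sigma\qquad\text{for all } n\in\mathbb{Z}^d,$$ where the constant $C(d,\sigma,E)$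 depends only on $d$, $\sigma$ and $E$. -/

import Mathlib

open MeasureTheory
open scoped InnerProductSpace CompactlySupported ENNReal ComplexConjugate

noncomputable section

set_option linter.unusedSimpArgs false

/-! ## The spectral resolution of a bounded self-adjoint operator -/

section SpectralResolution

variable {K : Type*} [NormedAddCommGroup K] [InnerProductSpace ℂ K] [CompleteSpace K]

/-- The positive linear functional `φ ↦ ⟨f, φ(A) f⟩` on the compactly supported continuous
functions on the line, with `φ(A)` given by the continuous functional calculus. -/
def spectralFunctional (A : K →L[ℂ] K) (f : K) : C_c(ℝ, ℝ) →ₚ[ℝ] ℝ :=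
  PositiveLinearMap.mk₀
    { toFun := fun φ => (⟪f, cfc (φ : ℝ → ℝ) A f⟫_ℂ).re
      map_add' := fun φ χ => by
        have h : cfc (⇑(φ + χ) : ℝ → ℝ) A = cfc (φ : ℝ → ℝ) A + cfc (χ : ℝ → ℝ) A :=
          cfc_add (a := A) (φ : ℝ → ℝ) (χ : ℝ → ℝ) φ.continuous.continuousOn
            χ.continuous.continuousOn
        rw [h, add_apply, inner_add_right, Complex.add_re]
      map_smul' := fun c φ => by
        have h : cfc (⇑(c • φ) : ℝ → ℝ) A = c • cfc (φ : ℝ → ℝ) A :=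
          cfc_smul (a := A) c (φ : ℝ → ℝ) φ.continuous.continuousOn
        rw [h, smul_apply, ← Complex.coe_smul, inner_smul_right,
          Complex.re_ofReal_mul, RingHom.id_apply, smul_eq_mul] }
    (fun φ hφ => by
      have h : 0 ≤ cfc (φ : ℝ → ℝ) A := cfc_nonneg fun x _ => hφ x
      exact ((ContinuousLinearMap.nonneg_iff_isPositive _).1 h).re_inner_nonneg_right f)

/-- The scalar spectral measure `μ_f` of `A` at the vector `f`: the regular Borel measure with
`∫ φ dμ_f = ⟨f, φ(A) f⟩` for every compactly supported continuous `φ`. -/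
def scalarSpectralMeasure (A : K →L[ℂ] K) (f : K) : Measure ℝ :=
  RealRMK.rieszMeasure (spectralFunctional A f)

theorem integral_scalarSpectralMeasure (A : K →L[ℂ] K) (f : K) (φ : C_c(ℝ, ℝ)) :
    ∫ x, φ x ∂(scalarSpectralMeasure A f) = (⟪f, cfc (φ : ℝ → ℝ) A f⟫_ℂ).re :=
  RealRMK.integral_rieszMeasure _ φ

instance regular_scalarSpectralMeasure (A : K →L[ℂ] K) (f : K) :
    (scalarSpectralMeasure A f).Regular :=
  RealRMK.regular_rieszMeasure _

theorem scalarSpectralMeasure_univ_le (A : K →L[ℂ] K) (f : K) :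
    scalarSpectralMeasure A f Set.univ ≤ ENNReal.ofReal (‖f‖ ^ 2) := by
  rw [isOpen_univ.measure_eq_iSup_isCompact]
  refine iSup₂_le fun C _ => iSup_le fun hC => ?_
  obtain ⟨φ, h1, -, hφc, hφ⟩ :=
    exists_continuous_one_zero_of_isCompact hC (isClosed_empty (X := ℝ)) (Set.disjoint_empty C)
  let g : C_c(ℝ, ℝ) := ⟨φ, hφc⟩
  refine (RealRMK.rieszMeasure_le_of_eq_one (spectralFunctional A f) (f := g)
    (fun x => (hφ x).1) hC (fun x hx => h1 hx)).trans (ENNReal.ofReal_le_ofReal ?_)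
  have hn : ‖cfc (g : ℝ → ℝ) A‖ ≤ 1 := norm_cfc_le zero_le_one fun x _ => by
    rw [Real.norm_eq_abs, abs_le]
    exact ⟨by linarith [(hφ x).1, show g x = φ x from rfl], (hφ x).2⟩
  calc (⟪f, cfc (g : ℝ → ℝ) A f⟫_ℂ).re ≤ ‖⟪f, cfc (g : ℝ → ℝ) A f⟫_ℂ‖ := Complex.re_le_norm _
    _ ≤ ‖f‖ * ‖cfc (g : ℝ → ℝ) A f‖ := norm_inner_le_norm _ _
    _ ≤ ‖f‖ * (1 * ‖f‖) := by
        gcongr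
        exact (ContinuousLinearMap.le_opNorm _ _).trans (by gcongr)
    _ = ‖f‖ ^ 2 := by ring

instance isFinite_scalarSpectralMeasure (A : K →L[ℂ] K) (f : K) :
    IsFiniteMeasure (scalarSpectralMeasure A f) :=
  ⟨(scalarSpectralMeasure_univ_le A f).trans_lt ENNReal.ofReal_lt_top⟩

theorem scalarSpectralMeasure_real_le (A : K →L[ℂ] K) (f : K) (B : Set ℝ) :
    (scalarSpectralMeasure A f).real B ≤ ‖f‖ ^ 2 :=
  ENNReal.toReal_le_of_le_ofReal (by positivity)
    ((measure_mono (Set.subset_univ B)).trans (scalarSpectralMeasure_univ_le A f))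

/-- A real linear relation among quadratic forms `⟨f_i, T f_i⟩`, valid for all operators `T`,
passes to the scalar spectral measures. -/
theorem sum_scalarSpectralMeasure_eq_zero (A : K →L[ℂ] K) (B : Set ℝ) {n : ℕ} (c : Fin n → ℝ)
    (f : Fin n → K) (h : ∀ T : K →L[ℂ] K, ∑ i, c i * (⟪f i, T (f i)⟫_ℂ).re = 0) :
    ∑ i, c i * (scalarSpectralMeasure A (f i)).real B = 0 := by
  have hint (φ : C_c(ℝ, ℝ)) (i : Fin n) : Integrable φ (scalarSpectralMeasure A (f i)) :=
    φ.continuous.integrable_of_hasCompactSupport φ.hasCompactSupport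
  have key : ∑ i, (c i).toNNReal • scalarSpectralMeasure A (f i)
      = ∑ i, (-c i).toNNReal • scalarSpectralMeasure A (f i) := by
    apply Measure.ext_of_integral_eq_on_compactlySupported
    intro φ
    rw [integral_finsetSum_measure fun i _ => (hint φ i).smul_measure_nnreal,
      integral_finsetSum_measure fun i _ => (hint φ i).smul_measure_nnreal, ← sub_eq_zero,
      ← Finset.sum_sub_distrib, ← h (cfc (φ : ℝ → ℝ) A)]
    refine Finset.sum_congr rfl fun i _ => ?_
    rw [integral_smul_nnreal_measure, integral_smul_nnreal_measure,
      integral_scalarSpectralMeasure, NNReal.smul_def, NNReal.smul_def, smul_eq_mul, smul_eq_mul,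
      ← sub_mul, Real.coe_toNNReal', Real.coe_toNNReal', max_zero_sub_max_neg_zero_eq_self]
  have h2 := congrArg (fun m : Measure ℝ => m.real B) key
  simp only [Measure.real, Measure.coe_finsetSum, Finset.sum_apply, Measure.smul_apply] at h2
  have hfin (a : NNReal) (i : Fin n) : a • scalarSpectralMeasure A (f i) B ≠ ∞ := by
    rw [ENNReal.smul_def, smul_eq_mul]
    finiteness
  rw [ENNReal.toReal_sum (fun i _ => hfin _ i), ENNReal.toReal_sum (fun i _ => hfin _ i), ← sub_eq_zero, ← Finset.sum_sub_distrib] at h2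
  rw [← h2]
  refine Finset.sum_congr rfl fun i _ => ?_
  simp only [ENNReal.smul_def, smul_eq_mul, ENNReal.toReal_mul, ENNReal.coe_toReal, ← sub_mul,
    Real.coe_toNNReal', max_zero_sub_max_neg_zero_eq_self, Measure.real]

/-- The polarization `⟨f, E(B) g⟩` of `f ↦ μ_f(B)`. -/
def spectralForm (A : K →L[ℂ] K) (B : Set ℝ) (f g : K) : ℂ :=
  (((scalarSpectralMeasure A (f + g)).real B - (scalarSpectralMeasure A (f - g)).real B : ℝ) +
    ((scalarSpectralMeasure A (f - Complex.I • g)).real B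
      - (scalarSpectralMeasure A (f + Complex.I • g)).real B : ℝ) * Complex.I) / 4

theorem spectralForm_add_right (A : K →L[ℂ] K) (B : Set ℝ) (f g h : K) :
    spectralForm A B f (g + h) = spectralForm A B f g + spectralForm A B f h := by
  have key (g h : K) := sum_scalarSpectralMeasure_eq_zero A B (n := 6) ![1, -1, -1, 1, -1, 1]
    ![f + (g + h), f - (g + h), f + g, f - g, f + h, f - h] (fun T => by
      simp [Fin.sum_univ_succ, inner_add_left, inner_add_right, inner_sub_left, inner_sub_right]
      ring)
  have h1 := key g h
  have h2 := key (Complex.I • g) (Complex.I • h)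
  simp [Fin.sum_univ_succ] at h1 h2
  apply Complex.ext
  · simp [spectralForm]
    linarith
  · simp [spectralForm, smul_add]
    linarith

theorem spectralForm_smul_right (A : K →L[ℂ] K) (B : Set ℝ) (f g : K) (c : ℂ) :
    spectralForm A B f (c • g) = c * spectralForm A B f g := by
  have key (c : ℂ) := sum_scalarSpectralMeasure_eq_zero A B (n := 6)
    ![1, -1, -c.re, c.re, c.im, -c.im]
    ![f + c • g, f - c • g, f + g, f - g, f - Complex.I • g, f + Complex.I • g] (fun T => by
      simp [Fin.sum_univ_succ, inner_add_left, inner_add_right, inner_sub_left, inner_sub_right,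
        inner_smul_left, inner_smul_right]
      ring)
  have h1 := key c
  have h2 := key (Complex.I * c)
  simp [Fin.sum_univ_succ] at h1 h2
  apply Complex.ext
  · simp [spectralForm]
    linarith
  · simp [spectralForm, smul_smul]
    linarith

theorem spectralForm_conj_symm (A : K →L[ℂ] K) (B : Set ℝ) (f g : K) :
    conj (spectralForm A B g f) = spectralForm A B f g := by
  have h1 := sum_scalarSpectralMeasure_eq_zero A B (n := 4) ![1, -1, -1, 1]
    ![g + f, g - f, f + g, f - g] (fun T => by
      simp [Fin.sum_univ_succ, inner_add_left, inner_add_right, inner_sub_left, inner_sub_right]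
      ring)
  have h2 := sum_scalarSpectralMeasure_eq_zero A B (n := 4) ![1, -1, 1, -1]
    ![g - Complex.I • f, g + Complex.I • f, f - Complex.I • g, f + Complex.I • g] (fun T => by
      simp [Fin.sum_univ_succ, inner_add_left, inner_add_right, inner_sub_left, inner_sub_right,
        inner_smul_left, inner_smul_right]
      ring)
  simp [Fin.sum_univ_succ] at h1 h2
  apply Complex.ext
  · simp [spectralForm, -map_div₀]
    linarith
  · simp [spectralForm, -map_div₀]
    linarith

theorem spectralForm_self (A : K →L[ℂ] K) (B : Set ℝ) (f : K) :
    spectralForm A B f f = ((scalarSpectralMeasure A f).real B : ℝ) := by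
  have h1 := sum_scalarSpectralMeasure_eq_zero A B (n := 3) ![1, -1, -(4 : ℝ)]
    ![f + f, f - f, f] (fun T => by
      simp only [Fin.sum_univ_three, map_add, inner_add_left, inner_add_right, Matrix.cons_val_zero,
        Matrix.cons_val_one, Matrix.cons_val, sub_self, map_zero, inner_zero_left,
        Complex.add_re, Complex.zero_re]
      ring)
  have h2 := sum_scalarSpectralMeasure_eq_zero A B (n := 2) ![1, -1]
    ![f - Complex.I • f, f + Complex.I • f] (fun T => by
      simp [Fin.sum_univ_succ, inner_add_left, inner_add_right, inner_sub_left, inner_sub_right,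
        inner_smul_left, inner_smul_right]
      ring)
  simp [Fin.sum_univ_succ] at h1 h2
  apply Complex.ext
  · simp [spectralForm]
    linarith
  · simp [spectralForm]
    linarith

theorem norm_spectralForm_le (A : K →L[ℂ] K) (B : Set ℝ) (f g : K) :
    ‖spectralForm A B f g‖ ≤ 1 * ‖f‖ * ‖g‖ := by
  let core : PreInnerProductSpace.Core ℂ K :=
    { inner := spectralForm A B
      conj_inner_symm := spectralForm_conj_symm A B
      re_inner_nonneg := fun f => by
        change 0 ≤ (spectralForm A B f f).re
        rw [spectralForm_self]
        exact measureReal_nonneg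
      add_left := fun f g h => by
        change spectralForm A B (f + g) h = spectralForm A B f h + spectralForm A B g h
        rw [← spectralForm_conj_symm, spectralForm_add_right, map_add, spectralForm_conj_symm,
          spectralForm_conj_symm]
      smul_left := fun f g c => by
        change spectralForm A B (c • f) g = conj c * spectralForm A B f g
        rw [← spectralForm_conj_symm, spectralForm_smul_right, map_mul, spectralForm_conj_symm] }
  have h : ‖spectralForm A B f g‖ * ‖spectralForm A B g f‖
      ≤ (spectralForm A B f f).re * (spectralForm A B g g).re :=
    InnerProductSpace.Core.inner_mul_inner_self_le (c := core) f g
  have hs : ‖spectralForm A B g f‖ = ‖spectralForm A B f g‖ := by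
    rw [← spectralForm_conj_symm A B f g, Complex.norm_conj]
  rw [hs, spectralForm_self, spectralForm_self, Complex.ofReal_re, Complex.ofReal_re] at h
  have h2 := mul_le_mul (scalarSpectralMeasure_real_le A f B) (scalarSpectralMeasure_real_le A g B)
    measureReal_nonneg (by positivity)
  refine abs_le_of_sq_le_sq' ?_ (by positivity) |>.2
  nlinarith

/-- The spectral resolution `E` of a bounded self-adjoint operator `A`: for a Borel set `B`,
`E(B)` is the bounded operator with `⟨f, E(B) f⟩ = μ_f(B)` for all `f`
(see `inner_spectralResolution_self`). -/
def spectralResolution (A : K →L[ℂ] K) (B : Set ℝ) : K →L[ℂ] K :=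
  ContinuousLinearMap.adjoint (InnerProductSpace.continuousLinearMapOfBilin
    (LinearMap.mkContinuous₂ (LinearMap.mk₂'ₛₗ (starRingEnd ℂ) (RingHom.id ℂ) (spectralForm A B)
      (fun f g h => by
        rw [← spectralForm_conj_symm, spectralForm_add_right, map_add, spectralForm_conj_symm,
          spectralForm_conj_symm])
      (fun c f g => by
        rw [← spectralForm_conj_symm, spectralForm_smul_right, map_mul, spectralForm_conj_symm,
          smul_eq_mul])
      (spectralForm_add_right A B)
      (fun c f g => by rw [spectralForm_smul_right, RingHom.id_apply, smul_eq_mul]))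
      1 (norm_spectralForm_le A B)))

theorem inner_spectralResolution (A : K →L[ℂ] K) (B : Set ℝ) (f g : K) :
    ⟪f, spectralResolution A B g⟫_ℂ = spectralForm A B f g := by
  rw [spectralResolution, ContinuousLinearMap.adjoint_inner_right,
    InnerProductSpace.continuousLinearMapOfBilin_apply]
  rfl

theorem inner_spectralResolution_self (A : K →L[ℂ] K) (B : Set ℝ) (f : K) :
    ⟪f, spectralResolution A B f⟫_ℂ = ((scalarSpectralMeasure A f).real B : ℝ) := by
  rw [inner_spectralResolution, spectralForm_self]

end SpectralResolution

/-! ## Discrete Schrödinger operators -/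

/-- The discrete Laplacian `(Δψ)(n) = ∑_j (ψ(n + e_j) + ψ(n - e_j))` on functions on `ℤ^d`. -/
def latticeLaplacian {𝕜 : Type*} [RCLike 𝕜] {d : ℕ} (ψ : (Fin d → ℤ) → 𝕜) (n : Fin d → ℤ) : 𝕜 :=
  ∑ j : Fin d, (ψ (n + Pi.single j 1) + ψ (n - Pi.single j 1))

/-- The formal Schrödinger operator `Hψ = Δψ + Vψ`, on arbitrary functions on `ℤ^d`. -/
def schrodinger {𝕜 : Type*} [RCLike 𝕜] {d : ℕ} (V : (Fin d → ℤ) → ℝ) (ψ : (Fin d → ℤ) → 𝕜)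
    (n : Fin d → ℤ) : 𝕜 :=
  latticeLaplacian ψ n + (V n : 𝕜) * ψ n

/-- The complex Hilbert space `ℓ²(ℤ^d)`. -/
abbrev LatticeL2 (d : ℕ) : Type := lp (fun _ : Fin d → ℤ => ℂ) 2

/-- The translation `(S_e f)(n) = f(n + e)` on `ℓ²(ℤ^d)`. -/
def latticeShift {d : ℕ} (e : Fin d → ℤ) : LatticeL2 d →L[ℂ] LatticeL2 d :=
  LinearMap.mkContinuous
    { toFun := fun f => ⟨fun n => f (n + e), by
        have h := (memℓp_gen_iff (by norm_num)).1 (lp.memℓp f)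
        refine (memℓp_gen_iff (p := 2) (f := fun n => f (n + e)) (by norm_num)).2 ?_
        exact (Equiv.addRight e).summable_iff.2 h⟩
      map_add' := fun f g => rfl
      map_smul' := fun c f => rfl }
    1 (fun f => by
      refine le_of_eq ?_
      rw [one_mul, lp.norm_eq_tsum_rpow (by norm_num), lp.norm_eq_tsum_rpow (by norm_num)]
      congr 1
      exact (Equiv.addRight e).tsum_eq (fun n => ‖f n‖ ^ (2 : ℝ≥0∞).toReal))

/-- Multiplication by a bounded real potential on `ℓ²(ℤ^d)`. -/
def potentialOperator {d : ℕ} (V : lp (fun _ : Fin d → ℤ => ℝ) ∞) :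
    LatticeL2 d →L[ℂ] LatticeL2 d :=
  have hV (f : LatticeL2 d) (n : Fin d → ℤ) :
      ‖(V n : ℂ) * f n‖ ≤ ‖((‖V‖ : ℂ) • f : LatticeL2 d) n‖ := by
    rw [lp.coeFn_smul, Pi.smul_apply, norm_smul, norm_mul, Complex.norm_real, Complex.norm_real,
      norm_norm]
    exact mul_le_mul_of_nonneg_right (lp.norm_apply_le_norm (by norm_num) V n) (norm_nonneg _)
  have hmem (f : LatticeL2 d) : Memℓp (fun n => (V n : ℂ) * f n) 2 := by
    have h := lp.memℓp ((‖V‖ : ℂ) • f)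
    rw [memℓp_gen_iff (by norm_num)] at h ⊢
    exact h.of_nonneg_of_le (fun n => by positivity)
      (fun n => Real.rpow_le_rpow (norm_nonneg _) (hV f n) (by norm_num))
  LinearMap.mkContinuous
    { toFun := fun f => ⟨fun n => (V n : ℂ) * f n, hmem f⟩
      map_add' := fun f g => lp.ext (funext fun n => mul_add (V n : ℂ) (f n) (g n))
      map_smul' := fun c f => lp.ext (funext fun n => mul_left_comm (V n : ℂ) c (f n)) }
    ‖V‖ (fun f => by
      have h := lp.norm_const_smul_le (p := 2) (by norm_num) (‖V‖ : ℂ) f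
      rw [Complex.norm_real, norm_norm] at h
      refine le_trans ?_ h
      rw [lp.norm_eq_tsum_rpow (by norm_num), lp.norm_eq_tsum_rpow (by norm_num)]
      refine Real.rpow_le_rpow (tsum_nonneg fun n => by positivity) ?_ (by norm_num)
      refine Summable.tsum_le_tsum
        (fun n => Real.rpow_le_rpow (norm_nonneg _) (hV f n) (by norm_num)) ?_ ?_
      · exact (memℓp_gen_iff (by norm_num)).1 (hmem f)
      · exact (memℓp_gen_iff (by norm_num)).1 (lp.memℓp ((‖V‖ : ℂ) • f)))

/-- `H = Δ + V` as a bounded operator on `ℓ²(ℤ^d)`. -/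
def schrodingerOperator {d : ℕ} (V : lp (fun _ : Fin d → ℤ => ℝ) ∞) :
    LatticeL2 d →L[ℂ] LatticeL2 d :=
  ∑ j : Fin d, (latticeShift (Pi.single j 1) + latticeShift (-Pi.single j 1)) + potentialOperator V

/-- On `ℓ²(ℤ^d)` the bounded operator acts by the formula for `Δ + V`. -/
theorem schrodingerOperator_apply {d : ℕ} (V : lp (fun _ : Fin d → ℤ => ℝ) ∞) (f : LatticeL2 d)
    (n : Fin d → ℤ) : schrodingerOperator V f n = schrodinger V f n := by
  simp only [schrodingerOperator, schrodinger, latticeLaplacian, add_apply,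
    sum_apply, lp.coeFn_add, lp.coeFn_sum, Pi.add_apply, Finset.sum_apply]
  simp only [sub_eq_add_neg]
  rfl

theorem isSelfAdjoint_schrodingerOperator {d : ℕ} (V : lp (fun _ : Fin d → ℤ => ℝ) ∞) :
    IsSelfAdjoint (schrodingerOperator V) := by
  have hs (e : Fin d → ℤ) : star (latticeShift e) = latticeShift (-e) := by
    rw [ContinuousLinearMap.star_eq_adjoint]
    refine ((ContinuousLinearMap.eq_adjoint_iff _ _).2 fun f g => ?_).symm
    rw [lp.inner_eq_tsum, lp.inner_eq_tsum, ← (Equiv.addRight e).tsum_eq]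
    refine tsum_congr fun n => ?_
    change ⟪f (n + e + -e), g (n + e)⟫_ℂ = ⟪f n, g (n + e)⟫_ℂ
    rw [add_neg_cancel_right]
  have hV : star (potentialOperator V) = potentialOperator V := by
    rw [ContinuousLinearMap.star_eq_adjoint]
    refine ((ContinuousLinearMap.eq_adjoint_iff _ _).2 fun f g => ?_).symm
    rw [lp.inner_eq_tsum, lp.inner_eq_tsum]
    refine tsum_congr fun n => ?_
    change ⟪(V n : ℂ) * f n, g n⟫_ℂ = ⟪f n, (V n : ℂ) * g n⟫_ℂ
    simp [mul_left_comm, mul_assoc]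
  rw [IsSelfAdjoint, schrodingerOperator, star_add, star_sum, hV]
  congr 1
  refine Finset.sum_congr rfl fun j _ => ?_
  rw [star_add, hs, hs, neg_neg, add_comm]

/-- The Japanese bracket `⟨n⟩ = (1 + |n|²)^(1/2)`, with `|n|` the Euclidean norm. -/
def japaneseBracket {d : ℕ} (n : Fin d → ℤ) : ℝ :=
  Real.sqrt (1 + ∑ j : Fin d, (n j : ℝ) ^ 2)

/-- A property of energies holds almost everywhere with respect to the spectral resolution of `A`:
it holds off a Borel set `N` with `E(N) = 0`. -/
def SpectrallyAE {K : Type*} [NormedAddCommGroup K] [InnerProductSpace ℂ K] [CompleteSpace K]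
    (A : K →L[ℂ] K) (p : ℝ → Prop) : Prop :=
  ∃ N : Set ℝ, MeasurableSet N ∧ spectralResolution A N = 0 ∧ ∀ E, E ∉ N → p E

end

/-!
The generalized eigenfunctions are densities of matrix elements of the spectral resolution. Put
`c_n = ⟨n⟩^(-σ)`. Since `2σ > d`, the squares `c_n²` are summable over `ℤ^d`, so that
`ρ = 4 ∑_n μ_{c_n δ_n}` is a finite measure (`isFiniteMeasure_weightedSpectralMeasure`), and its
Borel null sets are null for the spectral resolution
(`spectralResolution_eq_zero_of_weightedSpectralMeasure_eq_zero`).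

For each `m` the real signed measures `B ↦ Re ⟨c_m δ_m, E(B) c_n δ_n⟩` have densities `Φ_{mn}` with
respect to `ρ`. By polarization and the parallelogram identity `|Φ_{mn}| ≤ 1` almost everywhere
(`abs_spectralDensity_le_one`), and the function `ψ(n) = Φ_{mn}(E) / c_n` is therefore bounded by
`⟨n⟩^σ`. It solves `Hψ = Eψ` for almost every `E` (`schrodinger_spectralDensity`): tested against
`φ ∈ C_c(ℝ)`, this is the identity `φ(H) H = (φ · id)(H)` of the functional calculus. Finally `ψ`
is nonzero for a suitable `m` depending on `E`, because the diagonal densities `Φ_{mm}` cannot all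
vanish on a set of positive `ρ`-measure (`exists_spectralDensity_self_ne_zero`).
-/

/-! ### Scalar spectral measures -/

section SpectralDensity

variable {K : Type*} [NormedAddCommGroup K] [InnerProductSpace ℂ K] [CompleteSpace K]

theorem scalarSpectralMeasure_smul_of_norm_eq_one (A : K →L[ℂ] K) (f : K) {c : ℂ}
    (hc : ‖c‖ = 1) : scalarSpectralMeasure A (c • f) = scalarSpectralMeasure A f := by
  have h : spectralFunctional A (c • f) = spectralFunctional A f := by
    ext φ
    change (⟪c • f, cfc (φ : ℝ → ℝ) A (c • f)⟫_ℂ).re = (⟪f, cfc (φ : ℝ → ℝ) A f⟫_ℂ).re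
    rw [map_smul, inner_smul_left, inner_smul_right, ← mul_assoc, Complex.conj_mul', hc]
    simp
  rw [scalarSpectralMeasure, h, ← scalarSpectralMeasure]

/-- The inequality `‖E(B)(f + g)‖² ≤ 2 ‖E(B) f‖² + 2 ‖E(B) g‖²`, a consequence of the
parallelogram identity. -/
theorem scalarSpectralMeasure_add_le (A : K →L[ℂ] K) (f g : K) :
    scalarSpectralMeasure A (f + g)
      ≤ (2 : ℝ≥0∞) • scalarSpectralMeasure A f + (2 : ℝ≥0∞) • scalarSpectralMeasure A g := by
  refine Measure.le_iff.2 fun B _ => ?_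
  have h := sum_scalarSpectralMeasure_eq_zero A B (n := 4) ![1, 1, -2, -2]
    ![f + g, f - g, f, g] (fun T => by
      simp [Fin.sum_univ_succ]
      ring)
  simp [Fin.sum_univ_succ] at h
  have h0 : 0 ≤ (scalarSpectralMeasure A (f - g)).real B := measureReal_nonneg
  rw [Measure.add_apply, Measure.smul_apply, Measure.smul_apply, smul_eq_mul, smul_eq_mul,
    ← ENNReal.toReal_le_toReal (by finiteness) (by finiteness),
    ENNReal.toReal_add (by finiteness) (by finiteness), ENNReal.toReal_mul, ENNReal.toReal_mul]
  simp only [Measure.real] at h h0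
  simp only [ENNReal.toReal_ofNat]
  linarith

theorem scalarSpectralMeasure_add_smul_le (A : K →L[ℂ] K) (f g : K) {c : ℂ} (hc : ‖c‖ = 1) :
    scalarSpectralMeasure A (f + c • g)
      ≤ (2 : ℝ≥0∞) • scalarSpectralMeasure A f + (2 : ℝ≥0∞) • scalarSpectralMeasure A g := by
  have h := scalarSpectralMeasure_add_le A f (c • g)
  rwa [scalarSpectralMeasure_smul_of_norm_eq_one A g hc] at h

theorem spectralForm_eq_zero_of_measure_eq_zero (A : K →L[ℂ] K) {B : Set ℝ} {f g : K}
    (hf : scalarSpectralMeasure A f B = 0) (hg : scalarSpectralMeasure A g B = 0) :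
    spectralForm A B f g = 0 := by
  have key (c : ℂ) (hc : ‖c‖ = 1) : (scalarSpectralMeasure A (f + c • g)).real B = 0 := by
    have h := scalarSpectralMeasure_add_smul_le A f g hc B
    simp only [Measure.add_apply, Measure.smul_apply, hf, hg, smul_zero, add_zero] at h
    simp [Measure.real, nonpos_iff_eq_zero.1 h]
  have h1 := key 1 (by simp)
  have h2 := key (-1) (by simp)
  have h3 := key Complex.I (by simp)
  have h4 := key (-Complex.I) (by simp)
  simp only [one_smul, neg_smul, ← sub_eq_add_neg] at h1 h2 h3 h4
  simp [spectralForm, h1, h2, h3, h4]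

/-! ### Densities of the matrix elements of the spectral resolution -/

/-- The density with respect to `ρ` of the real signed measure `B ↦ Re ⟨f, E(B) g⟩`, written by
polarization as a difference of Radon–Nikodym derivatives. It represents that signed measure when
`ρ` dominates the scalar spectral measures of `f` and `g`. -/
noncomputable def spectralDensity (A : K →L[ℂ] K) (ρ : Measure ℝ) (f g : K) (E : ℝ) : ℝ :=
  (((scalarSpectralMeasure A (f + g)).rnDeriv ρ E).toReal
    - ((scalarSpectralMeasure A (f - g)).rnDeriv ρ E).toReal) / 4

theorem measurable_spectralDensity (A : K →L[ℂ] K) (ρ : Measure ℝ) (f g : K) :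
    Measurable (spectralDensity A ρ f g) := by
  unfold spectralDensity
  fun_prop

/-- If `ρ` dominates `4 μ_f` and `4 μ_g`, then it dominates `μ_{f + c g}` for `|c| = 1`. -/
theorem scalarSpectralMeasure_add_smul_le_of_le (A : K →L[ℂ] K) {ρ : Measure ℝ} {f g : K}
    (hf : (4 : ℝ≥0∞) • scalarSpectralMeasure A f ≤ ρ)
    (hg : (4 : ℝ≥0∞) • scalarSpectralMeasure A g ≤ ρ) {c : ℂ} (hc : ‖c‖ = 1) :
    scalarSpectralMeasure A (f + c • g) ≤ ρ := by
  refine (scalarSpectralMeasure_add_smul_le A f g hc).trans (Measure.le_iff'.2 fun B => ?_)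
  have h1 := hf B
  have h2 := hg B
  simp only [Measure.add_apply, Measure.smul_apply, smul_eq_mul] at h1 h2 ⊢
  rcases eq_or_ne (ρ B) ∞ with h | h
  · simp [h]
  rw [← ENNReal.toReal_le_toReal (by finiteness) h, ENNReal.toReal_mul] at h1 h2
  rw [← ENNReal.toReal_le_toReal (by finiteness) h,
    ENNReal.toReal_add (by finiteness) (by finiteness), ENNReal.toReal_mul, ENNReal.toReal_mul]
  simp only [ENNReal.toReal_ofNat] at h1 h2 ⊢
  linarith

theorem scalarSpectralMeasure_add_le_and_sub_le (A : K →L[ℂ] K) {ρ : Measure ℝ} {f g : K}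
    (hf : (4 : ℝ≥0∞) • scalarSpectralMeasure A f ≤ ρ)
    (hg : (4 : ℝ≥0∞) • scalarSpectralMeasure A g ≤ ρ) :
    scalarSpectralMeasure A (f + g) ≤ ρ ∧ scalarSpectralMeasure A (f - g) ≤ ρ := by
  have h1 := scalarSpectralMeasure_add_smul_le_of_le A hf hg (c := 1) (by simp)
  have h2 := scalarSpectralMeasure_add_smul_le_of_le A hf hg (c := -1) (by simp)
  simp only [one_smul, neg_smul, ← sub_eq_add_neg] at h1 h2
  exact ⟨h1, h2⟩

theorem abs_spectralDensity_le_one (A : K →L[ℂ] K) {ρ : Measure ℝ} [IsFiniteMeasure ρ] {f g : K}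
    (hf : (4 : ℝ≥0∞) • scalarSpectralMeasure A f ≤ ρ)
    (hg : (4 : ℝ≥0∞) • scalarSpectralMeasure A g ≤ ρ) :
    ∀ᵐ E ∂ρ, |spectralDensity A ρ f g E| ≤ 1 := by
  obtain ⟨h1, h2⟩ := scalarSpectralMeasure_add_le_and_sub_le A hf hg
  filter_upwards [Measure.rnDeriv_le_one_of_le h1, Measure.rnDeriv_le_one_of_le h2] with E e1 e2
  have k1 := ENNReal.toReal_mono ENNReal.one_ne_top e1
  have k2 := ENNReal.toReal_mono ENNReal.one_ne_top e2
  simp only [ENNReal.toReal_one] at k1 k2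
  have p1 := ENNReal.toReal_nonneg (a := (scalarSpectralMeasure A (f + g)).rnDeriv ρ E)
  have p2 := ENNReal.toReal_nonneg (a := (scalarSpectralMeasure A (f - g)).rnDeriv ρ E)
  rw [spectralDensity, abs_le]
  constructor <;> linarith

theorem integrable_spectralDensity (A : K →L[ℂ] K) {ρ : Measure ℝ} [IsFiniteMeasure ρ] {f g : K}
    (hf : (4 : ℝ≥0∞) • scalarSpectralMeasure A f ≤ ρ)
    (hg : (4 : ℝ≥0∞) • scalarSpectralMeasure A g ≤ ρ) :
    Integrable (spectralDensity A ρ f g) ρ :=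
  .of_bound (measurable_spectralDensity A ρ f g).aestronglyMeasurable 1
    (abs_spectralDensity_le_one A hf hg)

/-- The linear functional `g ↦ ⟨f, φ(A) g⟩`. -/
noncomputable def spectralPairing (A : K →L[ℂ] K) (f : K) (φ : C_c(ℝ, ℝ)) : K →L[ℂ] ℂ :=
  innerSL ℂ f ∘L cfc (φ : ℝ → ℝ) A

/-- An application of `A` to the second argument multiplies the symbol by the energy. -/
theorem spectralPairing_apply_apply {A : K →L[ℂ] K} (hA : IsSelfAdjoint A) (f g : K)
    {φ φ' : C_c(ℝ, ℝ)} (h : ∀ E, φ' E = φ E * E) :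
    spectralPairing A f φ (A g) = spectralPairing A f φ' g := by
  have hcfc := cfc_mul (a := A) (φ : ℝ → ℝ) id φ.continuous.continuousOn continuousOn_id
  rw [cfc_id ℝ A hA, show (fun x => φ x * id x) = φ' from funext fun E => (h E).symm] at hcfc
  rw [spectralPairing, spectralPairing, hcfc]
  rfl

/-- The spectral density represents the real part of the matrix elements `⟨f, φ(A) g⟩`. -/
theorem integral_mul_spectralDensity (A : K →L[ℂ] K) {ρ : Measure ℝ}
    [IsFiniteMeasure ρ] {f g : K}
    (hf : (4 : ℝ≥0∞) • scalarSpectralMeasure A f ≤ ρ)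
    (hg : (4 : ℝ≥0∞) • scalarSpectralMeasure A g ≤ ρ) (φ : C_c(ℝ, ℝ)) :
    ∫ E, φ E * spectralDensity A ρ f g E ∂ρ = (spectralPairing A f φ g).re := by
  change _ = (⟪f, cfc (φ : ℝ → ℝ) A g⟫_ℂ).re
  obtain ⟨h1, h2⟩ := scalarSpectralMeasure_add_le_and_sub_le A hf hg
  have a1 := Measure.absolutelyContinuous_of_le h1
  have a2 := Measure.absolutelyContinuous_of_le h2
  have hint (h : K) : Integrable φ (scalarSpectralMeasure A h) :=
    φ.continuous.integrable_of_hasCompactSupport φ.hasCompactSupport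
  have e1 := integral_toReal_rnDeriv_mul a1 (f := φ)
  have e2 := integral_toReal_rnDeriv_mul a2 (f := φ)
  have i1 := (integrable_rnDeriv_smul_iff a1).2 (hint (f + g))
  have i2 := (integrable_rnDeriv_smul_iff a2).2 (hint (f - g))
  have hsym : (⟪g, cfc (φ : ℝ → ℝ) A f⟫_ℂ).re = (⟪f, cfc (φ : ℝ → ℝ) A g⟫_ℂ).re := by
    have hs : IsSelfAdjoint (cfc (φ : ℝ → ℝ) A) := cfc_predicate _ _
    rw [← ContinuousLinearMap.adjoint_inner_left, ← ContinuousLinearMap.star_eq_adjoint,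
      hs.star_eq, ← inner_conj_symm, Complex.conj_re]
  have split : ∀ E, φ E * spectralDensity A ρ f g E
      = (((scalarSpectralMeasure A (f + g)).rnDeriv ρ E).toReal * φ E
        - ((scalarSpectralMeasure A (f - g)).rnDeriv ρ E).toReal * φ E) / 4 := fun E => by
    rw [spectralDensity]
    ring
  simp only [smul_eq_mul] at i1 i2
  simp_rw [split]
  rw [integral_div, integral_sub i1 i2, e1, e2, integral_scalarSpectralMeasure,
    integral_scalarSpectralMeasure]
  simp only [map_add, map_sub, inner_add_left, inner_add_right, inner_sub_left, inner_sub_right,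
    Complex.add_re, Complex.sub_re, hsym]
  ring

/-- On the diagonal the spectral density is the Radon–Nikodym derivative of `μ_f`. -/
theorem spectralDensity_self (A : K →L[ℂ] K) {ρ : Measure ℝ} [IsFiniteMeasure ρ] {f : K}
    (hf : (4 : ℝ≥0∞) • scalarSpectralMeasure A f ≤ ρ) :
    ∀ᵐ E ∂ρ, spectralDensity A ρ f f E = ((scalarSpectralMeasure A f).rnDeriv ρ E).toReal := by
  have hle : scalarSpectralMeasure A f ≪ ρ := by
    refine Measure.AbsolutelyContinuous.mk fun B _ hB => ?_
    have h := hf B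
    rw [hB] at h
    simpa using h
  refine ae_eq_of_integral_contDiff_smul_eq
    (integrable_spectralDensity A hf hf).locallyIntegrable
    Measure.integrable_toReal_rnDeriv.locallyIntegrable fun g hg hgs => ?_
  let φ : C_c(ℝ, ℝ) := ⟨⟨g, hg.continuous⟩, hgs⟩
  have h1 := integral_mul_spectralDensity A hf hf φ
  have h2 := integral_toReal_rnDeriv_mul hle (f := φ)
  rw [integral_scalarSpectralMeasure] at h2
  replace h2 := h2.trans h1.symm
  simp_rw [smul_eq_mul, mul_comm (g _)]
  simp_rw [mul_comm (φ _)] at h2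
  exact h2.symm

end SpectralDensity

/-! ### The polynomial weights -/

theorem japaneseBracket_pos {d : ℕ} (n : Fin d → ℤ) : 0 < japaneseBracket n :=
  Real.sqrt_pos.2 (by positivity)

theorem abs_le_japaneseBracket {d : ℕ} (n : Fin d → ℤ) (j : Fin d) :
    |(n j : ℝ)| ≤ japaneseBracket n := by
  refine Real.abs_le_sqrt ?_
  have h := Finset.single_le_sum (f := fun j => (n j : ℝ) ^ 2) (fun i _ => sq_nonneg _)
    (Finset.mem_univ j)
  linarith

theorem summable_japaneseBracket_rpow {d : ℕ} {r : ℝ} (hr : r < -(d : ℝ)) :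
    Summable fun n : Fin d → ℤ => japaneseBracket n ^ r := by
  let b := (Pi.basisFun ℝ (Fin d)).restrictScalars ℤ
  have hsum := ZLattice.summable_norm_rpow
    (Submodule.span ℤ (Set.range (Pi.basisFun ℝ (Fin d)))) r
    (by rwa [Module.finrank_eq_card_basis b, Fintype.card_fin])
  have hsum' := hsum.comp_injective b.equivFun.symm.injective
  have hb (n : Fin d → ℤ) (j : Fin d) :
      (b.equivFun.symm n : Fin d → ℝ) j = n j := by
    simp [b, Module.Basis.equivFun_symm_apply, Finset.sum_apply, Pi.single_apply]
  have hr0 : r ≤ 0 := by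
    have : (0 : ℝ) ≤ d := d.cast_nonneg
    linarith
  -- The origin is excluded: there `‖0‖ ^ r = 0` while the bracket equals one.
  refine hsum'.of_norm_bounded_eventually ?_
  refine (Set.finite_singleton (0 : Fin d → ℤ)).subset fun n hn => ?_
  by_contra h0
  refine hn ?_
  change ‖japaneseBracket n ^ r‖ ≤ ‖b.equivFun.symm n‖ ^ r
  rw [Real.norm_of_nonneg (Real.rpow_nonneg (japaneseBracket_pos n).le r)]
  refine Real.rpow_le_rpow_of_nonpos ?_ ?_ hr0
  · rw [norm_pos_iff]
    exact fun h => h0 (b.equivFun.symm.map_eq_zero_iff.1 h)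
  · rw [← Submodule.norm_coe, pi_norm_le_iff_of_nonneg (japaneseBracket_pos n).le]
    intro j
    rw [hb, Real.norm_eq_abs]
    exact abs_le_japaneseBracket n j

/-! ### The operator on the canonical basis -/

/-- The canonical basis vector `δ_n` of `ℓ²(ℤ^d)`. -/
noncomputable def latticeDelta {d : ℕ} (n : Fin d → ℤ) : LatticeL2 d :=
  lp.single 2 n (1 : ℂ)

theorem latticeShift_latticeDelta {d : ℕ} (e n : Fin d → ℤ) :
    latticeShift e (latticeDelta n) = latticeDelta (n - e) := by
  refine lp.ext (funext fun k => ?_)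
  change Pi.single (M := fun _ => ℂ) n 1 (k + e) = Pi.single (M := fun _ => ℂ) (n - e) 1 k
  simp only [Pi.single_apply, eq_sub_iff_add_eq]

theorem potentialOperator_latticeDelta {d : ℕ} (V : lp (fun _ : Fin d → ℤ => ℝ) ∞)
    (n : Fin d → ℤ) : potentialOperator V (latticeDelta n) = (V n : ℂ) • latticeDelta n := by
  refine lp.ext (funext fun k => ?_)
  change (V k : ℂ) * Pi.single (M := fun _ => ℂ) n 1 k
    = (V n : ℂ) * Pi.single (M := fun _ => ℂ) n 1 k
  rcases eq_or_ne k n with rfl | h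
  · simp
  · simp [h]

/-- The matrix of `H` in the canonical basis is real and symmetric, so the real part of a linear
functional, evaluated at `H δ_n`, is the formal operator `H` applied to the real parts of its values
on the basis vectors. -/
theorem re_map_schrodingerOperator_latticeDelta {d : ℕ} (V : lp (fun _ : Fin d → ℤ => ℝ) ∞)
    (L : LatticeL2 d →L[ℂ] ℂ) (n : Fin d → ℤ) :
    (L (schrodingerOperator V (latticeDelta n))).re
      = schrodinger (V : (Fin d → ℤ) → ℝ) (fun k => (L (latticeDelta k)).re) n := by
  simp only [schrodingerOperator, schrodinger, latticeLaplacian, add_apply, sum_apply,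
    latticeShift_latticeDelta, potentialOperator_latticeDelta, map_add, map_sum, map_smul,
    smul_eq_mul, sub_neg_eq_add, Complex.add_re, Complex.re_sum, Complex.re_ofReal_mul,
    RCLike.ofReal_real_eq_id, id_eq]
  congr 1
  exact Finset.sum_congr rfl fun j _ => add_comm _ _

/-- The spectral resolution vanishes on `N` as soon as all diagonal matrix elements do: by
polarization the off-diagonal ones vanish as well. -/
theorem spectralResolution_eq_zero {d : ℕ} (A : LatticeL2 d →L[ℂ] LatticeL2 d) {N : Set ℝ}
    (h : ∀ n, scalarSpectralMeasure A (latticeDelta n) N = 0) : spectralResolution A N = 0 := by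
  refine lp.ext_continuousLinearMap (ENNReal.ofNat_ne_top (n := 2)) fun n => ?_
  refine ContinuousLinearMap.ext_ring ?_
  refine lp.ext (funext fun m => ?_)
  have h1 := inner_spectralResolution A N (latticeDelta m) (latticeDelta n)
  rw [spectralForm_eq_zero_of_measure_eq_zero A (h m) (h n), latticeDelta,
    lp.inner_single_left] at h1
  simpa [latticeDelta] using h1

/-! ### Generalized eigenfunctions -/

theorem integral_schrodinger {d : ℕ} {α : Type*} [MeasurableSpace α] (ρ : Measure α)
    (V : (Fin d → ℤ) → ℝ) (u : (Fin d → ℤ) → α → ℝ) (hu : ∀ k, Integrable (u k) ρ)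
    (n : Fin d → ℤ) :
    ∫ x, schrodinger V (fun k => u k x) n ∂ρ = schrodinger V (fun k => ∫ x, u k x ∂ρ) n := by
  have h (j : Fin d) :
      Integrable (fun x => u (n + Pi.single j 1) x + u (n - Pi.single j 1) x) ρ :=
    (hu _).add (hu _)
  simp only [schrodinger, latticeLaplacian]
  rw [integral_add (integrable_finsetSum _ fun j _ => h j) ((hu n).const_mul _),
    integral_finsetSum _ fun j _ => h j, integral_const_mul]
  simp_rw [integral_add (hu _) (hu _)]

/-- Multiplication of a spectral density by the energy corresponds to an application of `H`. This
yields the eigenvalue equation for `n ↦ Re ⟨f, E(dλ) δ_n⟩ / ρ(dλ)`, where the basis vectors are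
given up to the positive factors `c n` which make them subordinate to `ρ`. -/
theorem schrodinger_spectralDensity {d : ℕ} (V : lp (fun _ : Fin d → ℤ => ℝ) ∞) {ρ : Measure ℝ}
    [IsFiniteMeasure ρ] {f : LatticeL2 d} {c : (Fin d → ℤ) → ℝ} (hc : ∀ n, 0 < c n)
    (hf : (4 : ℝ≥0∞) • scalarSpectralMeasure (schrodingerOperator V) f ≤ ρ)
    (hg : ∀ n, (4 : ℝ≥0∞) • scalarSpectralMeasure (schrodingerOperator V)
      ((c n : ℂ) • latticeDelta n) ≤ ρ) (n : Fin d → ℤ) :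
    ∀ᵐ E ∂ρ,
      schrodinger (V : (Fin d → ℤ) → ℝ) (fun k => (c k)⁻¹ *
        spectralDensity (schrodingerOperator V) ρ f ((c k : ℂ) • latticeDelta k) E) n
      = E * ((c n)⁻¹ *
        spectralDensity (schrodingerOperator V) ρ f ((c n : ℂ) • latticeDelta n) E) := by
  set A := schrodingerOperator V
  have hsa : IsSelfAdjoint A := isSelfAdjoint_schrodingerOperator V
  let u (k : Fin d → ℤ) (E : ℝ) : ℝ :=
    (c k)⁻¹ * spectralDensity A ρ f ((c k : ℂ) • latticeDelta k) E
  have hu (k : Fin d → ℤ) : Integrable (u k) ρ :=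
    (integrable_spectralDensity A hf (hg k)).const_mul _
  have hL (φ : C_c(ℝ, ℝ)) (k : Fin d → ℤ) :
      ∫ E, φ E * u k E ∂ρ = (spectralPairing A f φ (latticeDelta k)).re := by
    have h1 : ∀ E, φ E * u k E
        = (c k)⁻¹ * (φ E * spectralDensity A ρ f ((c k : ℂ) • latticeDelta k) E) :=
      fun E => mul_left_comm _ _ _
    simp_rw [h1]
    rw [integral_const_mul, integral_mul_spectralDensity A hf (hg k)]
    rw [map_smul, smul_eq_mul, Complex.re_ofReal_mul, inv_mul_cancel_left₀ (hc k).ne']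
  -- Two integrable functions with the same integrals against all test functions `φ` agree a.e.;
  -- testing with `φ` reduces the claim to `⟨f, φ(H) H δ_n⟩ = ⟨f, φ'(H) δ_n⟩`, `φ'(E) = φ(E) E`.
  have hs : Integrable (fun E => schrodinger (V : (Fin d → ℤ) → ℝ) (fun k => u k E) n) ρ := by
    simp only [schrodinger, latticeLaplacian]
    exact (integrable_finsetSum _ fun j _ => (hu _).add (hu _)).add ((hu n).const_mul _)
  refine ae_eq_of_integral_contDiff_smul_eq hs.locallyIntegrable ?_ fun g hgc hgs => ?_
  · exact (hu n).locallyIntegrable.continuous_mul continuous_id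
  let φ : C_c(ℝ, ℝ) := ⟨⟨g, hgc.continuous⟩, hgs⟩
  let φ' : C_c(ℝ, ℝ) := ⟨⟨fun E => g E * E, hgc.continuous.mul continuous_id⟩, hgs.mul_right⟩
  have hgu (k : Fin d → ℤ) : Integrable (fun E => φ E * u k E) ρ := by
    obtain ⟨C, hC⟩ := φ.hasCompactSupport.exists_bound_of_continuous φ.continuous
    exact (hu k).bdd_mul φ.continuous.aestronglyMeasurable (Filter.Eventually.of_forall hC)
  have e1 : ∀ E, g E • schrodinger (V : (Fin d → ℤ) → ℝ) (fun k => u k E) n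
      = schrodinger (V : (Fin d → ℤ) → ℝ) (fun k => φ E * u k E) n := fun E => by
    simp only [schrodinger, latticeLaplacian, smul_eq_mul, mul_add, Finset.mul_sum]
    congr 1
    exact mul_left_comm _ _ _
  have e2 : ∀ E, g E • (E * u n E) = φ' E * u n E := fun E => (mul_assoc _ _ _).symm
  change ∫ E, g E • schrodinger (V : (Fin d → ℤ) → ℝ) (fun k => u k E) n ∂ρ
    = ∫ E, g E • (E * u n E) ∂ρ
  simp_rw [e1, e2]
  rw [integral_schrodinger ρ _ (fun k E => φ E * u k E) hgu]
  simp_rw [hL]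
  rw [← re_map_schrodingerOperator_latticeDelta,
    spectralPairing_apply_apply hsa f _ (φ' := φ') fun _ => rfl]

/-- The finite measure `4 ∑_n μ_{c_n δ_n}` for a weight `c`; it has the same null sets as the
spectral resolution when `c` is positive. The factor `4` makes it dominate the polarizations
`μ_{c_m δ_m ± c_n δ_n}`. -/
noncomputable def weightedSpectralMeasure {d : ℕ} (A : LatticeL2 d →L[ℂ] LatticeL2 d)
    (c : (Fin d → ℤ) → ℝ) : Measure ℝ :=
  (4 : ℝ≥0∞) • Measure.sum fun n => scalarSpectralMeasure A ((c n : ℂ) • latticeDelta n)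

theorem isFiniteMeasure_weightedSpectralMeasure {d : ℕ} (A : LatticeL2 d →L[ℂ] LatticeL2 d)
    {c : (Fin d → ℤ) → ℝ} (hc : Summable fun n => c n ^ 2) :
    IsFiniteMeasure (weightedSpectralMeasure A c) := by
  refine ⟨?_⟩
  rw [weightedSpectralMeasure, Measure.smul_apply, Measure.sum_apply _ MeasurableSet.univ,
    smul_eq_mul]
  refine ENNReal.mul_lt_top (by finiteness) (lt_of_le_of_lt (ENNReal.tsum_le_tsum fun n =>
    scalarSpectralMeasure_univ_le A ((c n : ℂ) • latticeDelta n)) ?_)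
  have h (n : Fin d → ℤ) : ‖(c n : ℂ) • (latticeDelta n : LatticeL2 d)‖ ^ 2 = c n ^ 2 := by
    rw [norm_smul, latticeDelta, lp.norm_single (by norm_num), norm_one, mul_one,
      Complex.norm_real, Real.norm_eq_abs, sq_abs]
  simp_rw [h]
  rw [← ENNReal.ofReal_tsum_of_nonneg (fun n => sq_nonneg _) hc]
  exact ENNReal.ofReal_lt_top

theorem smul_scalarSpectralMeasure_le_weightedSpectralMeasure {d : ℕ}
    (A : LatticeL2 d →L[ℂ] LatticeL2 d) (c : (Fin d → ℤ) → ℝ) (n : Fin d → ℤ) :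
    (4 : ℝ≥0∞) • scalarSpectralMeasure A ((c n : ℂ) • latticeDelta n)
      ≤ weightedSpectralMeasure A c := by
  have h := Measure.le_sum (fun n => scalarSpectralMeasure A ((c n : ℂ) • latticeDelta n)) n
  refine Measure.le_iff'.2 fun B => ?_
  simp only [weightedSpectralMeasure, Measure.smul_apply, smul_eq_mul]
  exact mul_le_mul_right (h B) _

theorem spectralResolution_eq_zero_of_weightedSpectralMeasure_eq_zero {d : ℕ}
    (A : LatticeL2 d →L[ℂ] LatticeL2 d) {c : (Fin d → ℤ) → ℝ} (hc : ∀ n, 0 < c n) {N : Set ℝ}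
    (hN : weightedSpectralMeasure A c N = 0) : spectralResolution A N = 0 := by
  refine spectralResolution_eq_zero A fun n => ?_
  have h0 : scalarSpectralMeasure A ((c n : ℂ) • latticeDelta n) N = 0 := by
    have h := smul_scalarSpectralMeasure_le_weightedSpectralMeasure A c n N
    rw [hN] at h
    simpa using h
  have h := sum_scalarSpectralMeasure_eq_zero A N (n := 2) ![1, -(c n ^ 2)]
    ![(c n : ℂ) • latticeDelta n, latticeDelta n] (fun T => by
      simp only [Fin.sum_univ_two, Matrix.cons_val_zero, Matrix.cons_val_one,
        map_smul, inner_smul_left, inner_smul_right, Complex.conj_ofReal, Complex.re_ofReal_mul]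
      ring)
  simp only [Fin.sum_univ_two, Matrix.cons_val_zero, Matrix.cons_val_one, Measure.real, h0,
    ENNReal.toReal_zero, mul_zero, zero_add, mul_eq_zero, neg_eq_zero] at h
  rcases h with h | h
  · exact absurd h (pow_ne_zero 2 (hc n).ne')
  · exact ((ENNReal.toReal_eq_zero_iff _).1 h).resolve_right (by finiteness)

/-- The diagonal densities do not vanish simultaneously: a set on which they all do is null for
every `μ_{c_n δ_n}`, hence for their sum. -/
theorem exists_spectralDensity_self_ne_zero {d : ℕ} (A : LatticeL2 d →L[ℂ] LatticeL2 d)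
    {c : (Fin d → ℤ) → ℝ} (hc : Summable fun n => c n ^ 2) :
    ∀ᵐ E ∂(weightedSpectralMeasure A c), ∃ m, spectralDensity A (weightedSpectralMeasure A c)
      ((c m : ℂ) • latticeDelta m) ((c m : ℂ) • latticeDelta m) E ≠ 0 := by
  have := isFiniteMeasure_weightedSpectralMeasure A hc
  set ρ := weightedSpectralMeasure A c with hρ
  have hle := smul_scalarSpectralMeasure_le_weightedSpectralMeasure A c
  let S : Set ℝ :=
    {E | ∀ m, (scalarSpectralMeasure A ((c m : ℂ) • latticeDelta m)).rnDeriv ρ E = 0}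
  have hS : MeasurableSet S := by
    simp only [S, Set.ofPred_forall]
    exact MeasurableSet.iInter fun m =>
      Measure.measurable_rnDeriv _ _ (measurableSet_singleton 0)
  have hS0 (m : Fin d → ℤ) : scalarSpectralMeasure A ((c m : ℂ) • latticeDelta m) S = 0 := by
    have hac : scalarSpectralMeasure A ((c m : ℂ) • latticeDelta m) ≪ ρ := by
      refine Measure.AbsolutelyContinuous.mk fun B _ hB => ?_
      have h := hle m B
      rw [← hρ, hB] at h
      simpa using h
    rw [← Measure.setLIntegral_rnDeriv hac S]
    exact (setLIntegral_congr_fun hS fun E hE => hE m).trans (by simp)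
  have hρS : ρ S = 0 := by
    rw [hρ, weightedSpectralMeasure, Measure.smul_apply, Measure.sum_apply _ hS]
    rw [ENNReal.tsum_eq_zero.2 hS0, smul_zero]
  filter_upwards [measure_eq_zero_iff_ae_notMem.1 hρS,
    ae_all_iff.2 fun m => spectralDensity_self A (hle m),
    ae_all_iff.2 fun m =>
      Measure.rnDeriv_ne_top (scalarSpectralMeasure A ((c m : ℂ) • latticeDelta m)) ρ]
    with E h1 h2 h3
  by_contra! h
  refine h1 fun m => ?_
  have h4 := h m
  rw [h2 m, ENNReal.toReal_eq_zero_iff] at h4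
  exact h4.resolve_right (h3 m)

theorem mainTheorem2 (d : ℕ) (σ : ℝ) (hσ : (d : ℝ) / 2 < σ) :
    ∃ C : ℝ → ℝ, ∀ V : lp (fun _ : Fin d → ℤ => ℝ) ∞,
      SpectrallyAE (schrodingerOperator V) fun E =>
        ∃ ψ : (Fin d → ℤ) → ℝ, ψ ≠ 0 ∧ (∀ n, schrodinger V ψ n = E * ψ n) ∧
          ∀ n, |ψ n| ≤ C E * japaneseBracket n ^ σ := by
  -- The densities of the normalized vectors are bounded by one, so the constant `1` works.
  refine ⟨fun _ => 1, fun V => ?_⟩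
  set A := schrodingerOperator V
  let c (n : Fin d → ℤ) : ℝ := japaneseBracket n ^ (-σ)
  have hc (n : Fin d → ℤ) : 0 < c n := Real.rpow_pos_of_pos (japaneseBracket_pos n) _
  have hc2 : Summable fun n => c n ^ 2 := by
    refine (summable_japaneseBracket_rpow (r := -(2 * σ)) (by linarith)).congr fun n => ?_
    rw [← Real.rpow_mul_natCast (japaneseBracket_pos n).le]
    congr 1
    push_cast
    ring
  have := isFiniteMeasure_weightedSpectralMeasure A hc2
  set ρ := weightedSpectralMeasure A c with hρ
  have hle := smul_scalarSpectralMeasure_le_weightedSpectralMeasure A c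
  have hae : ∀ᵐ E ∂ρ, ∃ ψ : (Fin d → ℤ) → ℝ, ψ ≠ 0 ∧ (∀ n, schrodinger V ψ n = E * ψ n) ∧
      ∀ n, |ψ n| ≤ 1 * japaneseBracket n ^ σ := by
    filter_upwards [exists_spectralDensity_self_ne_zero A hc2,
      ae_all_iff.2 fun m => ae_all_iff.2 fun n =>
        schrodinger_spectralDensity V hc (hle m) hle n,
      ae_all_iff.2 fun m => ae_all_iff.2 fun n => abs_spectralDensity_le_one A (hle m) (hle n)]
      with E ⟨m, hm⟩ h2 h3
    refine ⟨fun n => (c n)⁻¹ * spectralDensity A ρ ((c m : ℂ) • latticeDelta m)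
      ((c n : ℂ) • latticeDelta n) E, fun h => ?_, h2 m, fun n => ?_⟩
    · exact mul_ne_zero (inv_ne_zero (hc m).ne') hm (congrFun h m)
    · rw [abs_mul, abs_of_pos (inv_pos.2 (hc n)), mul_comm, ← Real.rpow_neg
        (japaneseBracket_pos n).le, neg_neg]
      exact mul_le_mul_of_nonneg_right (h3 m n)
        (Real.rpow_nonneg (japaneseBracket_pos n).le σ)
  -- A `ρ`-null set has a Borel `ρ`-null hull, and `ρ`-null sets have spectral projection zero.
  refine ⟨toMeasurable ρ {E | ¬ ∃ ψ : (Fin d → ℤ) → ℝ, ψ ≠ 0 ∧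
    (∀ n, schrodinger V ψ n = E * ψ n) ∧ ∀ n, |ψ n| ≤ 1 * japaneseBracket n ^ σ},
    measurableSet_toMeasurable _ _, ?_, fun E hE => ?_⟩
  · refine spectralResolution_eq_zero_of_weightedSpectralMeasure_eq_zero A hc ?_
    rw [← hρ, measure_toMeasurable]
    exact ae_iff.1 hae
  · by_contra h
    exact hE (subset_toMeasurable _ _ h)
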